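/- Let $(A,B,C)$ be a nontrivial solution of the equation $A!\,B!=C!$, that is, a triple of positive integers with $A!\,B!=C!$ and $A\le B\le C-2$, and suppose that $(A,B,C)\neq(6,7,10)$. Then $B\ge 10^{3000}$ and $$A\le \frac{\log(B+1)}{\log 2}+\frac{2\log\log(B+1)}{\log 2}-1.3479,$$ $$C-B\le \frac{\log\log(B+1)}{\log 2}-0.8803,$$ $$B-A> C-\frac{\log(C+1)}{\log 2}-\frac{3\log\log(C+1)}{\log 2}+2.2282,$$ where $\log$ denotes the natural logarithm. -/

import Mathlib

/-- `(A, B, C)` is a nontrivial solution of the equation `A! B! = C!` in positive integers: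
`A ≤ B ≤ C - 2` (the last inequality is written without natural-number subtraction). -/
def IsNontrivialSolution (A B C : ℕ) : Prop :=
  0 < A ∧ A ≤ B ∧ B + 2 ≤ C ∧ A.factorial * B.factorial = C.factorial

/-! Cancelling `B!` gives `A! = (B+1)⋯(B+k)` with `k = C - B ≥ 2`, and two estimates compete.
Two-adically, `v₂(A!) ≥ A - log₂(A+1)`, while one factor `t` of the product carries its whole
valuation up to `v₂((k-1)!) < k - 1`; hence `2^(A+2) ≤ (A+1)(B+k)2^k`, so that `A` exceeds `log₂ B`
only by about `log₂ A + k`. By size, `(B+1)^k ≤ A!`, so `k log B` is at most about `A log A`.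
Together they make `k` logarithmic in `A`. Once `log (B+1) ≥ 6900`, Stirling's bound and a short
bootstrap (`log_bounds`) give the bounds for `A` and `C - B`; the third inequality is their sum.

To exclude `B < 10^3000`, note that then `A < 10240` and `k ≤ 14`. Now `A!` is a polynomial in `t`
without constant term. Reverting this series writes a fixed multiple `c * t` as a polynomial in `A!`
modulo `t^m`. Since `2^(A-25)` divides `t` while `t ≤ B + k` is far below the modulus, that
polynomial in `A!` would have an abnormally small residue modulo a large power of two. A computation
shows that it never does for `150 ≤ A` (`not_checkAll`, `checkFrom_block`). For `A < 150` direct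
tests (`checkSmall_of_lt`) leave only `6! = 8·9·10`. -/

/-! ### Two-adic valuation of factorials and of products of consecutive integers. -/

/-- The number of ones in the binary expansion of `n` is at most `log₂ (n + 1)`. -/
theorem two_pow_digits_sum_le (n : ℕ) : 2 ^ (Nat.digits 2 n).sum ≤ n + 1 := by
  induction n using Nat.strong_induction_on with
  | _ n ih =>
    rcases Nat.eq_zero_or_pos n with rfl | hn
    · simp
    · rw [Nat.digits_def' (by norm_num) hn, List.sum_cons, pow_add]
      have h := ih (n / 2) (Nat.div_lt_self hn (by norm_num))
      rcases Nat.mod_two_eq_zero_or_one n with h0 | h0 <;> rw [h0] <;> omega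

theorem digits_sum_add_padicValNat_factorial (n : ℕ) :
    (Nat.digits 2 n).sum + padicValNat 2 n.factorial = n := by
  have h := sub_one_mul_padicValNat_factorial (p := 2) n
  have h' := Nat.digit_sum_le 2 n
  omega

theorem two_pow_le_succ_mul_two_pow_padicValNat_factorial (n : ℕ) :
    2 ^ n ≤ (n + 1) * 2 ^ padicValNat 2 n.factorial := by
  calc 2 ^ n = 2 ^ (Nat.digits 2 n).sum * 2 ^ padicValNat 2 n.factorial := by
        rw [← pow_add, digits_sum_add_padicValNat_factorial]
    _ ≤ _ := Nat.mul_le_mul_right _ (two_pow_digits_sum_le n)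

theorem padicValNat_two_factorial_lt {n : ℕ} (hn : 0 < n) : padicValNat 2 n.factorial < n := by
  have h := digits_sum_add_padicValNat_factorial n
  have : (Nat.digits 2 n).sum ≠ 0 := by
    intro h0
    have h1 := List.sum_eq_zero_iff.1 h0
    have h2 := Nat.getLast_digit_ne_zero 2 hn.ne'
    exact h2 (h1 _ (List.getLast_mem _))
  omega

/-- Meant for the factors on one side of the term of largest valuation: each is compared with its
distance `j + 1` from that term. -/
theorem padicValNat_prod_range_le (f : ℕ → ℕ) (n : ℕ) (hf : ∀ j < n, f j ≠ 0)
    (h : ∀ j < n, padicValNat 2 (f j) ≤ padicValNat 2 (j + 1)) :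
    padicValNat 2 (∏ j ∈ Finset.range n, f j) ≤ padicValNat 2 n.factorial := by
  induction n with
  | zero => simp
  | succ n ih =>
    have hp : ∏ j ∈ Finset.range n, f j ≠ 0 :=
      Finset.prod_ne_zero_iff.2 fun j hj => hf j (by have := Finset.mem_range.1 hj; omega)
    rw [Finset.prod_range_succ, Nat.factorial_succ, mul_comm,
      padicValNat.mul (hf n (by omega)) hp,
      padicValNat.mul (by omega) (Nat.factorial_ne_zero n)]
    exact add_le_add (h n (by omega)) (ih (fun j hj => hf j (by omega)) fun j hj => h j (by omega))

/-- A product of consecutive integers, centred at one of its factors. -/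
theorem prod_range_add_centred (x i r : ℕ) :
    ∏ j ∈ Finset.range (i + r + 1), (x + j) =
      (x + i) * ((∏ j ∈ Finset.range i, (x + i - (j + 1))) *
        ∏ j ∈ Finset.range r, (x + i + (j + 1))) := by
  rw [show i + r + 1 = i + (1 + r) by ring, Finset.prod_range_add, Finset.prod_range_add,
    ← Finset.prod_range_reflect]
  have h1 : ∏ j ∈ Finset.range i, (x + (i - 1 - j)) =
      ∏ j ∈ Finset.range i, (x + i - (j + 1)) :=
    Finset.prod_congr rfl fun j hj => by
      have := Finset.mem_range.1 hj
      omega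
  have h2 : ∏ j ∈ Finset.range r, (x + (i + (1 + j))) =
      ∏ j ∈ Finset.range r, (x + i + (j + 1)) :=
    Finset.prod_congr rfl fun j _ => by ring
  rw [h1, h2]
  simp
  ring

/-- Among `k` consecutive positive integers one carries all powers of two of their product, up to
those of `(k - 1)!`. -/
theorem exists_padicValNat_prod_range_le (x k : ℕ) (hx : 0 < x) (hk : 0 < k) :
    ∃ i r, i + r + 1 = k ∧ padicValNat 2 (∏ j ∈ Finset.range k, (x + j)) ≤
      padicValNat 2 (x + i) + padicValNat 2 (k - 1).factorial := by
  obtain ⟨i, hi, hmax⟩ := Finset.exists_max_image (Finset.range k)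
    (fun j => padicValNat 2 (x + j)) ⟨0, Finset.mem_range.2 hk⟩
  have hik := Finset.mem_range.1 hi
  obtain ⟨r, rfl⟩ : ∃ r, k = i + r + 1 := ⟨k - i - 1, by omega⟩
  refine ⟨i, r, rfl, ?_⟩
  -- By maximality of `i`, the power of two in `x + j` divides `x + i` as well, hence their
  -- distance.
  have hdvd : ∀ j < i + r + 1, 2 ^ padicValNat 2 (x + j) ∣ x + i := fun j hj =>
    (pow_dvd_pow 2 (hmax j (Finset.mem_range.2 hj))).trans pow_padicValNat_dvd
  have h1 : padicValNat 2 (∏ j ∈ Finset.range i, (x + i - (j + 1))) ≤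
      padicValNat 2 i.factorial := by
    apply padicValNat_prod_range_le
    · intro j hj; omega
    · intro j hj
      rw [← padicValNat_dvd_iff_le (by omega)]
      have e : x + i - (j + 1) = x + (i - (j + 1)) := by omega
      have := Nat.dvd_sub (hdvd (i - (j + 1)) (by omega))
        (pow_padicValNat_dvd (p := 2) (n := x + (i - (j + 1))))
      rw [e]
      rwa [show x + i - (x + (i - (j + 1))) = j + 1 by omega] at this
  have h2 : padicValNat 2 (∏ j ∈ Finset.range r, (x + i + (j + 1))) ≤
      padicValNat 2 r.factorial := by
    apply padicValNat_prod_range_le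
    · intro j hj; omega
    · intro j hj
      rw [← padicValNat_dvd_iff_le (by omega)]
      have := Nat.dvd_sub (pow_padicValNat_dvd (p := 2) (n := x + (i + (j + 1))))
        (hdvd (i + (j + 1)) (by omega))
      rw [add_assoc x]
      rwa [show x + (i + (j + 1)) - (x + i) = j + 1 by omega] at this
  have n1 : ∏ j ∈ Finset.range i, (x + i - (j + 1)) ≠ 0 :=
    Finset.prod_ne_zero_iff.2 fun j hj => by have := Finset.mem_range.1 hj; omega
  have n2 : ∏ j ∈ Finset.range r, (x + i + (j + 1)) ≠ 0 :=
    Finset.prod_ne_zero_iff.2 fun j hj => by omega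
  rw [prod_range_add_centred, padicValNat.mul (by omega) (mul_ne_zero n1 n2), padicValNat.mul n1 n2]
  have h3 : padicValNat 2 (i.factorial * r.factorial) ≤ padicValNat 2 (i + r).factorial := by
    rw [← padicValNat_dvd_iff_le (Nat.factorial_ne_zero _)]
    exact pow_padicValNat_dvd.trans (Nat.factorial_mul_factorial_dvd_factorial_add i r)
  rw [padicValNat.mul (Nat.factorial_ne_zero _) (Nat.factorial_ne_zero _)] at h3
  simp only [Nat.add_sub_cancel]
  omega

theorem IsNontrivialSolution.exists_prod {A B C : ℕ} (h : IsNontrivialSolution A B C) :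
    ∃ k, 2 ≤ k ∧ C = B + k ∧ A ≤ B ∧
      A.factorial = ∏ j ∈ Finset.range k, (B + 1 + j) := by
  obtain ⟨_, hAB, hBC, hfac⟩ := h
  refine ⟨C - B, by omega, by omega, hAB, ?_⟩
  have h1 := Nat.factorial_mul_ascFactorial B (C - B)
  rw [show B + (C - B) = C by omega, ← hfac, mul_comm] at h1
  rw [← Nat.ascFactorial_eq_prod_range]
  exact (Nat.eq_of_mul_eq_mul_right (Nat.factorial_pos B) h1).symm

section consecutive

variable {A B k : ℕ}

theorem two_pow_le_of_factorial_eq_prod (hk : 2 ≤ k)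
    (h : A.factorial = ∏ j ∈ Finset.range k, (B + 1 + j)) :
    2 ^ (A + 2) ≤ (A + 1) * (B + k) * 2 ^ k := by
  obtain ⟨i, r, hir, hv⟩ := exists_padicValNat_prod_range_le (B + 1) k (by omega) (by omega)
  rw [← h] at hv
  have h1 := padicValNat_two_factorial_lt (n := k - 1) (by omega)
  have h2 : 2 ^ padicValNat 2 (B + 1 + i) ≤ B + k :=
    (Nat.le_of_dvd (by omega) pow_padicValNat_dvd).trans (by omega)
  calc 2 ^ (A + 2) = 2 ^ A * 2 ^ 2 := pow_add _ _ _
    _ ≤ (A + 1) * 2 ^ padicValNat 2 A.factorial * 2 ^ 2 :=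
        Nat.mul_le_mul_right _ (two_pow_le_succ_mul_two_pow_padicValNat_factorial A)
    _ = (A + 1) * 2 ^ (padicValNat 2 A.factorial + 2) := by rw [pow_add, mul_assoc]
    _ ≤ (A + 1) * 2 ^ (padicValNat 2 (B + 1 + i) + k) :=
        Nat.mul_le_mul_left _ (Nat.pow_le_pow_right (by norm_num) (by omega))
    _ = (A + 1) * 2 ^ padicValNat 2 (B + 1 + i) * 2 ^ k := by rw [pow_add, mul_assoc]
    _ ≤ _ := Nat.mul_le_mul_right _ (Nat.mul_le_mul_left _ h2)

theorem succ_pow_le_of_factorial_eq_prod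
    (h : A.factorial = ∏ j ∈ Finset.range k, (B + 1 + j)) : (B + 1) ^ k ≤ A.factorial := by
  rw [h]
  calc (B + 1) ^ k = ∏ _j ∈ Finset.range k, (B + 1) := by simp
    _ ≤ _ := Finset.prod_le_prod' fun j _ => by omega

end consecutive

/-! ### Size against valuation: `k` is logarithmic in `A`. -/

theorem pow_succ_add_le_succ_pow (a n : ℕ) :
    a ^ (n + 1) + (n + 1) * a ^ n ≤ (a + 1) ^ (n + 1) := by
  induction n with
  | zero => simp
  | succ n ih =>
    calc a ^ (n + 2) + (n + 2) * a ^ (n + 1)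
        ≤ (a ^ (n + 1) + (n + 1) * a ^ n) * (a + 1) := by
          have : 0 ≤ (n + 1) * a ^ n := Nat.zero_le _
          ring_nf at this ⊢
          omega
      _ ≤ (a + 1) ^ (n + 1) * (a + 1) := Nat.mul_le_mul_right _ ih
      _ = _ := (pow_succ _ _).symm

/-- Induction by Bernoulli: `2 (n+1)^(n+1) ≤ (n+2)^(n+1)`. The factor `2^n` is the source of the `-
1` in `mul_logb_le_of_factorial_eq_prod`. -/
theorem two_pow_mul_factorial_le (n : ℕ) : 2 ^ n * n.factorial ≤ (n + 1) ^ n := by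
  induction n with
  | zero => simp
  | succ n ih =>
    calc 2 ^ (n + 1) * (n + 1).factorial = 2 * (n + 1) * (2 ^ n * n.factorial) := by
          rw [pow_succ, Nat.factorial_succ]; ring
      _ ≤ 2 * (n + 1) * (n + 1) ^ n := Nat.mul_le_mul_left _ ih
      _ = (n + 1) ^ (n + 1) + (n + 1) * (n + 1) ^ n := by ring
      _ ≤ _ := pow_succ_add_le_succ_pow (n + 1) n

theorem two_mul_sq_logb_succ_le {A : ℕ} (hA : 150 ≤ A) :
    2 * Real.logb 2 ((A : ℝ) + 1) ^ 2 ≤ A := by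
  set n := Nat.log 2 (A + 1)
  have h1 : 2 ^ n ≤ A + 1 := Nat.pow_log_le_self 2 (by omega)
  have h2 : A + 1 < 2 ^ (n + 1) := Nat.lt_pow_succ_log_self (by norm_num) _
  have h3 : Real.logb 2 ((A : ℝ) + 1) ≤ n + 1 := by
    rw [Real.logb_le_iff_le_rpow (by norm_num) (by positivity)]
    have : ((A + 1 : ℕ) : ℝ) ≤ ((2 ^ (n + 1) : ℕ) : ℝ) := by exact_mod_cast h2.le
    rw [show (n : ℝ) + 1 = ((n + 1 : ℕ) : ℝ) by push_cast; ring, Real.rpow_natCast]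
    exact_mod_cast this
  have h0 : 0 ≤ Real.logb 2 ((A : ℝ) + 1) :=
    Real.logb_nonneg (by norm_num) (by linarith [(Nat.cast_nonneg A : (0 : ℝ) ≤ A)])
  have hn : 7 ≤ n := by
    by_contra hn
    have : 2 ^ (n + 1) ≤ 2 ^ 7 := Nat.pow_le_pow_right (by norm_num) (by omega)
    omega
  have key : 2 * (n + 1) ^ 2 ≤ A := by
    rcases Nat.eq_or_lt_of_le hn with h7 | h8
    · rw [← h7]; omega
    · have : ∀ m, 8 ≤ m → 2 * (m + 1) ^ 2 + 1 ≤ 2 ^ m := by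
        intro m hm
        induction m, hm using Nat.le_induction with
        | base => norm_num
        | succ m hm ih => rw [pow_succ 2 m]; nlinarith
      have := this n h8
      omega
  have key' : 2 * ((n : ℝ) + 1) ^ 2 ≤ A := by exact_mod_cast key
  nlinarith

section consecutive

variable {A B k : ℕ}

/-- The two-adic bound in logarithmic form. -/
theorem add_two_le_logb_of_factorial_eq_prod (hk : 2 ≤ k)
    (h : A.factorial = ∏ j ∈ Finset.range k, (B + 1 + j)) :
    (A : ℝ) + 2 ≤ Real.logb 2 ((A : ℝ) + 1) + Real.logb 2 ((B : ℝ) + k) + k := by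
  have h1 := two_pow_le_of_factorial_eq_prod hk h
  have hk' : (2 : ℝ) ≤ k := by exact_mod_cast hk
  have h2 : (2 : ℝ) ^ (A + 2) ≤ ((A : ℝ) + 1) * (B + k) * 2 ^ k := by exact_mod_cast h1
  have h3 := Real.logb_le_logb_of_le (b := 2) (by norm_num) (by positivity) h2
  rw [Real.logb_mul (by positivity) (by positivity), Real.logb_mul (by positivity) (by positivity),
    Real.logb_pow, Real.logb_pow, Real.logb_self_eq_one (by norm_num)] at h3
  push_cast at h3
  linarith

theorem mul_logb_le_of_factorial_eq_prod
    (h : A.factorial = ∏ j ∈ Finset.range k, (B + 1 + j)) :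
    (k : ℝ) * Real.logb 2 ((B : ℝ) + 1) ≤ A * (Real.logb 2 ((A : ℝ) + 1) - 1) := by
  have h1 : 2 ^ A * (B + 1) ^ k ≤ (A + 1) ^ A :=
    (Nat.mul_le_mul_left _ (succ_pow_le_of_factorial_eq_prod h)).trans (two_pow_mul_factorial_le A)
  have h2 : (2 : ℝ) ^ A * ((B : ℝ) + 1) ^ k ≤ ((A : ℝ) + 1) ^ A := by exact_mod_cast h1
  have h3 := Real.logb_le_logb_of_le (b := 2) (by norm_num) (by positivity) h2
  rw [Real.logb_mul (by positivity) (by positivity), Real.logb_pow, Real.logb_pow, Real.logb_pow,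
    Real.logb_self_eq_one (by norm_num)] at h3
  linarith

/-- Eliminating `log₂ (B+1)` leaves `k (A + 1 - L - k) ≤ A (L - 1)`, where `L = log₂ (A+1)`. The
left side is concave in `k`, so this fails between `L + 1` and `A (L - 1) / L`; the size bound with
`A ≤ B` puts `k` below the upper end. -/
theorem lt_logb_succ_add_one_of_factorial_eq_prod (hA : 150 ≤ A) (hAB : A ≤ B) (hk : 2 ≤ k)
    (h : A.factorial = ∏ j ∈ Finset.range k, (B + 1 + j)) :
    (k : ℝ) < Real.logb 2 ((A : ℝ) + 1) + 1 := by
  have F1 := add_two_le_logb_of_factorial_eq_prod hk h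
  have F2 := mul_logb_le_of_factorial_eq_prod h
  have hA' : (150 : ℝ) ≤ A := by exact_mod_cast hA
  have hAB' : (A : ℝ) ≤ B := by exact_mod_cast hAB
  have F3 : Real.logb 2 ((A : ℝ) + 1) ≤ Real.logb 2 ((B : ℝ) + 1) :=
    Real.logb_le_logb_of_le (by norm_num) (by positivity) (by linarith)
  have hL := two_mul_sq_logb_succ_le hA
  have hL1 : 1 < Real.logb 2 ((A : ℝ) + 1) := by
    rw [Real.lt_logb_iff_rpow_lt (by norm_num) (by positivity)]
    norm_num; linarith
  set L := Real.logb 2 ((A : ℝ) + 1)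
  have hkL : (k : ℝ) * L ≤ A * (L - 1) := (mul_le_mul_of_nonneg_left F3 (by positivity)).trans F2
  have hkA : (k : ℝ) ≤ A := by nlinarith
  have F4 : Real.logb 2 ((B : ℝ) + k) ≤ Real.logb 2 ((B : ℝ) + 1) + 1 := by
    have : Real.logb 2 (((B : ℝ) + 1) * 2) = Real.logb 2 ((B : ℝ) + 1) + 1 := by
      rw [Real.logb_mul (by positivity) (by norm_num), Real.logb_self_eq_one (by norm_num)]
    rw [← this]
    exact Real.logb_le_logb_of_le (by norm_num) (by positivity) (by linarith)
  set x := Real.logb 2 ((B : ℝ) + 1)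
  by_contra! hcon
  have F5 : (k : ℝ) * (A + 1 - L - k) ≤ A * (L - 1) :=
    (mul_le_mul_of_nonneg_left (by linarith) (by positivity)).trans F2
  -- The product of the distances of `k` to the two ends of that interval; added to `L` times `F5`
  -- it cancels the `k²` terms.
  have F6 := mul_nonneg (sub_nonneg.2 hcon) (sub_nonneg.2 hkL)
  have F7 : (k : ℝ) * (A - 2 * L ^ 2) + A * (L - 1) ≤ 0 := by nlinarith
  have F8 : 0 ≤ (k : ℝ) * (A - 2 * L ^ 2) := mul_nonneg (by positivity) (by linarith)
  have F9 : 0 < (A : ℝ) * (L - 1) := mul_pos (by linarith) (by linarith)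
  linarith

end consecutive

/-! ### The residue tests. -/

/-- Unless this test succeeds, `P - Q` may be congruent modulo `2 ^ e` to an integer of absolute
value less than `2 ^ (e - 30)`. The test is written with the functions that the kernel evaluates on
numerals. -/
def farFromZero (e P Q : ℕ) : Bool :=
  Nat.ble (Nat.pow 2 (Nat.sub e 29))
    (Nat.mod (Nat.add (Nat.add P (Nat.pow 2 (Nat.sub e 30)))
      (Nat.sub (Nat.pow 2 e) (Nat.mod Q (Nat.pow 2 e)))) (Nat.pow 2 e))

/-- The number of binary digits to which an expansion of order `m` in a factor of `A!` divisible by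
`2 ^ (A - 25)` is compared. -/
def precision (m A : ℕ) : ℕ :=
  cond (Nat.ble (Nat.mul m (Nat.sub A 25)) 10400) (Nat.mul m (Nat.sub A 25)) 10400

/-- Inverse series of `N = t (t + 1)`, with signed Catalan coefficients 1, -1, 2, -5, 14. For `N = t
(t - 1)` the same polynomial gives `-t`, so one test serves both positions of `t`. -/
def check2 (e F G : ℕ) : Bool :=
  farFromZero e (Nat.mul F (Nat.add 1 (Nat.mul G (Nat.add 2 (Nat.mul 14 G)))))
    (Nat.mul G (Nat.add 1 (Nat.mul 5 G)))

/-- The three tests treat `t` as the middle, first and last of three factors, with the inverse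
series taken to order 4 and denominators cleared. -/
def check3 (e F G : ℕ) : Bool :=
  farFromZero e (Nat.mul F (Nat.add 1 G)) 0 &&
  (farFromZero e (Nat.mul F (Nat.add 4 (Nat.mul 4 G))) (Nat.mul 3 G) &&
  farFromZero e (Nat.mul F (Nat.add 4 (Nat.add (Nat.mul 3 F) (Nat.mul 4 G)))) 0)

def check4 (e F G : ℕ) : Bool :=
  farFromZero e (Nat.mul 36 F) (Nat.mul 11 G) &&
  farFromZero e (Nat.add (Nat.mul 4 F) G) 0

/-- Inverse series to order 3. With `t` in the middle, `N = t (t² - 1)(t² - 4)` has no quadratic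
term, hence the test of `F` alone. -/
def check5 (e F G : ℕ) : Bool :=
  farFromZero e F 0 &&
  (farFromZero e (Nat.mul 576 F) (Nat.mul 50 G) &&
  (farFromZero e (Nat.add (Nat.mul 576 F) (Nat.mul 50 G)) 0 &&
  (farFromZero e (Nat.mul 36 F) (Nat.mul 5 G) &&
  farFromZero e (Nat.add (Nat.mul 36 F) (Nat.mul 5 G)) 0)))

/-- All tests for `A`, where `F` is congruent to `A!` modulo `2 ^ 10400` and `G = F ^ 2`: the first
serves products of at least six consecutive integers, `check2`, …, `check5` shorter ones. -/
def checkAll (A F G : ℕ) : Bool :=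
  farFromZero (precision 2 A) F 0 && (check2 (precision 6 A) F G &&
  (check3 (precision 4 A) F G && (check4 (precision 3 A) F G && check5 (precision 3 A) F G)))

/-- The tests for `n` consecutive values of `A`, keeping track of `A!` modulo `2 ^ 10400`. -/
def checkFrom (n : ℕ) : ℕ → ℕ → Bool :=
  Nat.rec (fun _ _ => true)
    (fun _ ih A F => (Nat.ble A 149 || checkAll A F (Nat.mul F F)) &&
      ih (Nat.succ A) (Nat.mod (Nat.mul F (Nat.succ A)) (Nat.pow 2 10400))) n

/-- The product of the `2 ^ d` integers following `a`. -/
def factorialTree (d : ℕ) : ℕ → ℕ :=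
  Nat.rec (fun a => Nat.succ a)
    (fun d ih a => Nat.mul (ih a) (ih (Nat.add a (Nat.pow 2 d)))) d

/-- `(512 * j)!` modulo `2 ^ 10400`. -/
def blockFactorial (j : ℕ) : ℕ :=
  Nat.rec 1 (fun i ih =>
    Nat.mod (Nat.mul ih (factorialTree 9 (Nat.mul 512 i))) (Nat.pow 2 10400)) j

/-! ### Soundness of the tests and the range `150 ≤ A < 10240`. -/

/-- If `P - Q ≡ z` for such a `z`, the tested residue would be `z + 2^(e-30)`, which lies strictly
between 0 and `2^(e-29)`. -/
theorem farFromZero_not_modEq {e P Q : ℕ} (he : 30 ≤ e) (h : farFromZero e P Q = true) {z : ℤ}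
    (hz : |z| < 2 ^ (e - 30)) : ¬ (2 ^ e : ℤ) ∣ (P : ℤ) - Q - z := by
  intro hdvd
  have h1 : 2 ^ (e - 29) ≤ (P + 2 ^ (e - 30) + (2 ^ e - Q % 2 ^ e)) % 2 ^ e := Nat.le_of_ble_eq_true h
  have hQ : Q % 2 ^ e ≤ 2 ^ e := (Nat.mod_lt _ (by positivity)).le
  have h2 : ((2 ^ (e - 29) : ℕ) : ℤ) ≤
      (((P + 2 ^ (e - 30) + (2 ^ e - Q % 2 ^ e)) % 2 ^ e : ℕ) : ℤ) := by exact_mod_cast h1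
  have hpow : (2 : ℤ) ^ (e - 29) = 2 * 2 ^ (e - 30) := by
    rw [← pow_succ']; congr 1; omega
  have hlt : (2 : ℤ) ^ (e - 29) < 2 ^ e := pow_lt_pow_right₀ (by norm_num) (by omega)
  push_cast [Nat.cast_sub hQ] at h2
  have hz' := abs_lt.1 hz
  have h3 : ((P : ℤ) + 2 ^ (e - 30) + (2 ^ e - (Q : ℤ) % 2 ^ e)) % 2 ^ e = z + 2 ^ (e - 30) := by
    rw [← Int.emod_eq_of_lt (a := z + 2 ^ (e - 30)) (b := 2 ^ e) (by linarith) (by linarith)]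
    apply Int.emod_emod_of_dvd _ (dvd_refl _) |>.symm.trans
    rw [Int.emod_emod_of_dvd _ (dvd_refl _)]
    apply Int.ModEq.symm
    rw [Int.modEq_iff_dvd]
    have hq : (Q : ℤ) % 2 ^ e = Q - 2 ^ e * ((Q : ℤ) / 2 ^ e) := Int.emod_def _ _
    obtain ⟨w, hw⟩ := hdvd
    exact ⟨w + 1 + (Q : ℤ) / 2 ^ e, by rw [hq]; linear_combination hw⟩
  rw [h3] at h2
  linarith

theorem precision_eq (m A : ℕ) : precision m A = min (m * (A - 25)) 10400 := by
  have : precision m A = cond (Nat.ble (m * (A - 25)) 10400) (m * (A - 25)) 10400 := rfl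
  rw [this]
  rcases Nat.lt_or_ge 10400 (m * (A - 25)) with h | h
  · have : Nat.ble (m * (A - 25)) 10400 = false := by
      rw [Bool.eq_false_iff]; intro h'; exact absurd (Nat.le_of_ble_eq_true h') (by omega)
    rw [this, min_eq_right h.le]; rfl
  · rw [Nat.ble_eq_true_of_le h, min_eq_left h]; rfl

/-- With `two_pow_mul_factorial_le` this yields `A! < 2^(12 A - 684)`. The bound 5225 is where `2 (A
- 25)` reaches 10400. -/
theorem succ_pow_self_lt_two_pow {A : ℕ} (h₁ : 150 ≤ A) (h₂ : A ≤ 5225) :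
    (A + 1) ^ A < 2 ^ (13 * A - 684) := by
  rcases Nat.lt_or_ge A 256 with h | h
  · calc (A + 1) ^ A ≤ (2 ^ 8) ^ A := Nat.pow_le_pow_left (by omega) _
      _ = 2 ^ (8 * A) := (pow_mul _ _ _).symm
      _ < _ := Nat.pow_lt_pow_right (by norm_num) (by omega)
  rcases Nat.lt_or_ge A 1024 with h | h
  · calc (A + 1) ^ A ≤ (2 ^ 10) ^ A := Nat.pow_le_pow_left (by omega) _
      _ = 2 ^ (10 * A) := (pow_mul _ _ _).symm
      _ < _ := Nat.pow_lt_pow_right (by norm_num) (by omega)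
  rcases Nat.lt_or_ge A 2048 with h | h
  · calc (A + 1) ^ A ≤ (2 ^ 11) ^ A := Nat.pow_le_pow_left (by omega) _
      _ = 2 ^ (11 * A) := (pow_mul _ _ _).symm
      _ < _ := Nat.pow_lt_pow_right (by norm_num) (by omega)
  · refine lt_of_pow_lt_pow_left₀ 2 (by positivity) ?_
    calc ((A + 1) ^ A) ^ 2 = ((A + 1) ^ 2) ^ A := pow_right_comm _ _ _
      _ ≤ (2 ^ 25) ^ A := Nat.pow_le_pow_left
          ((Nat.pow_le_pow_left (by omega : A + 1 ≤ 5226) 2).trans (by norm_num)) _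
      _ = 2 ^ (25 * A) := (pow_mul _ _ _).symm
      _ < 2 ^ ((13 * A - 684) * 2) := Nat.pow_lt_pow_right (by norm_num) (by omega)
      _ = _ := pow_mul _ _ _

/-- The small residue `c * t` really is small. If the precision is capped at 10400, `B < 10^3000`
suffices; otherwise `(B+1)^k ≤ A!` bounds `B`, and `m k ≥ 12` beats the exponent in `A! < 2^(12 A -
684)`. -/
theorem mul_lt_two_pow_precision {A B k m : ℕ} (hA : 150 ≤ A) (hAB : A ≤ B) (hk : 2 ≤ k)
    (hk' : k ≤ 14) (hm : 2 ≤ m) (hmk : 12 ≤ m * k) (hB : B < 10 ^ 3000)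
    (h : (B + 1) ^ k ≤ A.factorial) : 2 ^ 33 * (B + k) < 2 ^ (precision m A - 30) := by
  rw [precision_eq]
  rcases Nat.lt_or_ge 10400 (m * (A - 25)) with hc | hc
  · rw [min_eq_right hc.le]
    calc 2 ^ 33 * (B + k) ≤ 2 ^ 33 * (10 ^ 3000 + 14) := Nat.mul_le_mul_left _ (by omega)
      _ < 2 ^ (10400 - 30) := by
        set_option exponentiation.threshold 20000 in norm_num
  · rw [min_eq_left hc]
    have hA2 : A ≤ 5225 := by
      have : 2 * (A - 25) ≤ m * (A - 25) := Nat.mul_le_mul_right _ hm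
      omega
    by_contra! hcon
    have h250 : 250 ≤ m * (A - 25) := by
      calc 250 ≤ 2 * (A - 25) := by omega
        _ ≤ _ := Nat.mul_le_mul_right _ hm
    have h1 : 2 ^ (m * (A - 25) - 64) ≤ B + 1 := by
      have : 2 ^ 34 * 2 ^ (m * (A - 25) - 64) ≤ 2 ^ 34 * (B + 1) := by
        rw [← pow_add, show 34 + (m * (A - 25) - 64) = m * (A - 25) - 30 by omega]
        omega
      exact Nat.le_of_mul_le_mul_left this (by positivity)
    -- The constant 684 is forced by `k = 6`, `m = 2`: `6 (2 (A - 25) - 64) = 12 A - 684`.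
    have h2 : 12 * A - 684 ≤ (m * (A - 25) - 64) * k := by
      obtain ⟨a, rfl⟩ : ∃ a, A = a + 25 := ⟨A - 25, by omega⟩
      rw [Nat.add_sub_cancel, Nat.sub_mul]
      rcases Nat.lt_or_ge k 6 with h6 | h6
      · have : 12 * a ≤ m * k * a := Nat.mul_le_mul_right _ hmk
        have e : m * a * k = m * k * a := by ring
        omega
      · have : 2 * a * k ≤ m * a * k := by gcongr
        have : (2 * a - 64) * 6 ≤ (2 * a - 64) * k := Nat.mul_le_mul_left _ h6
        have e : (2 * a - 64) * k = 2 * a * k - 64 * k := Nat.sub_mul _ _ _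
        omega
    have h3 := (Nat.pow_le_pow_left h1 k).trans h
    rw [← pow_mul] at h3
    have h4 := (Nat.mul_le_mul_left (2 ^ A) ((Nat.pow_le_pow_right two_pos h2).trans h3)).trans
      (two_pow_mul_factorial_le A)
    rw [← pow_add, show A + (12 * A - 684) = 13 * A - 684 by omega] at h4
    exact absurd (succ_pow_self_lt_two_pow hA hA2) (by omega)

/-- The product of `i` integers below `t`, of `t`, and of `r` integers above `t` is
`(-1) ^ i i! r! t` up to a multiple of `t ^ 2`. -/
theorem sq_dvd_centred_prod_sub (t : ℤ) (i r : ℕ) :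
    t ^ 2 ∣ t * ((∏ j ∈ Finset.range i, (t - (j + 1))) * ∏ j ∈ Finset.range r, (t + (j + 1))) -
      ((-1) ^ i * i.factorial * r.factorial : ℤ) * t := by
  have h1 : ∏ j ∈ Finset.range i, (t - (j + 1)) ≡ (-1) ^ i * i.factorial [ZMOD t] := by
    have e : ((-1) ^ i * i.factorial : ℤ) = ∏ j ∈ Finset.range i, (-((j : ℤ) + 1)) := by
      rw [Finset.prod_neg, ← Finset.prod_range_add_one_eq_factorial]; push_cast; simp
    rw [e]
    exact Int.ModEq.prod fun j _ => (Int.modEq_iff_dvd.2 ⟨-1, by ring⟩)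
  have h2 : ∏ j ∈ Finset.range r, (t + (j + 1)) ≡ r.factorial [ZMOD t] := by
    have e : (r.factorial : ℤ) = ∏ j ∈ Finset.range r, ((j : ℤ) + 1) := by
      rw [← Finset.prod_range_add_one_eq_factorial]; push_cast; rfl
    rw [e]
    exact Int.ModEq.prod fun j _ => (Int.modEq_iff_dvd.2 ⟨-1, by ring⟩)
  obtain ⟨w, hw⟩ := Int.modEq_iff_dvd.1 (h1.mul h2)
  exact ⟨-w, by linear_combination -t * hw⟩

theorem cast_prod_range_centred (x i r : ℕ) (hx : 0 < x) :
    ((∏ j ∈ Finset.range (i + r + 1), (x + j) : ℕ) : ℤ) =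
      ((x + i : ℕ) : ℤ) * ((∏ j ∈ Finset.range i, (((x + i : ℕ) : ℤ) - (j + 1))) *
        ∏ j ∈ Finset.range r, (((x + i : ℕ) : ℤ) + (j + 1))) := by
  rw [prod_range_add_centred]
  have h1 : ((∏ j ∈ Finset.range i, (x + i - (j + 1)) : ℕ) : ℤ) =
      ∏ j ∈ Finset.range i, (((x + i : ℕ) : ℤ) - (j + 1)) := by
    rw [Nat.cast_prod]
    exact Finset.prod_congr rfl fun j hj => by
      have := Finset.mem_range.1 hj
      rw [Nat.cast_sub (by omega)]
      push_cast; ring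
  push_cast at h1 ⊢
  rw [h1]

/-- One application of `farFromZero`: if `S` is a polynomial in `A!` that agrees with `c * t` up to
order `m` in the factor `t` of `A!`, then the test excludes the factorization. -/
theorem not_farFromZero {A B k m P Q : ℕ} {M S c t : ℤ} (hA : 150 ≤ A) (hAB : A ≤ B) (hk : 2 ≤ k)
    (hk' : k ≤ 14) (hm : 2 ≤ m) (hmk : 12 ≤ m * k) (hB : B < 10 ^ 3000)
    (h : (B + 1) ^ k ≤ A.factorial) (ht : 0 ≤ t) (htB : t ≤ B + k) (h2t : 2 ^ (A - 25) ∣ t)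
    (hM : M = 2 ^ 10400) (hfar : farFromZero (precision m A) P Q = true)
    (hS : (P : ℤ) - Q ≡ S [ZMOD M]) (hser : t ^ m ∣ S - c * t) (hc : |c| ≤ 2 ^ 33) : False := by
  have he : 30 ≤ precision m A := by
    have : 2 * (A - 25) ≤ m * (A - 25) := Nat.mul_le_mul_right _ hm
    rw [precision_eq]; omega
  have hsize : |c * t| < 2 ^ (precision m A - 30) := by
    have h1 := mul_lt_two_pow_precision hA hAB hk hk' hm hmk hB h
    have h2 : (2 : ℤ) ^ 33 * (B + k) < 2 ^ (precision m A - 30) := by exact_mod_cast h1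
    rw [abs_mul, abs_of_nonneg ht]
    exact (mul_le_mul hc htB ht (by norm_num)).trans_lt h2
  refine farFromZero_not_modEq he hfar hsize ?_
  have d1 : (2 : ℤ) ^ precision m A ∣ P - Q - S := by
    refine (pow_dvd_pow 2 ?_).trans (hM ▸ (Int.modEq_iff_dvd.1 hS.symm))
    rw [precision_eq]; omega
  have d2 : (2 : ℤ) ^ precision m A ∣ S - c * t := by
    refine Dvd.dvd.trans ?_ hser
    refine Dvd.dvd.trans ?_ (pow_dvd_pow_of_dvd h2t m)
    rw [← pow_mul]
    refine pow_dvd_pow 2 ?_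
    rw [precision_eq, mul_comm]; omega
  have := dvd_add d1 d2
  rwa [sub_add_sub_cancel] at this

/-- The 25 is 13 + 12: `v₂(A!) ≥ A - 13` because `A + 1 < 2^14`, and `v₂((k-1)!) ≤ 12` because `k ≤
14`. -/
theorem two_pow_dvd_of_padicValNat_le {A k t : ℕ} (hA : A < 16383) (hk : 2 ≤ k) (hk' : k ≤ 14)
    (h : padicValNat 2 A.factorial ≤ padicValNat 2 t + padicValNat 2 (k - 1).factorial) :
    2 ^ (A - 25) ∣ t := by
  have h1 := padicValNat_two_factorial_lt (n := k - 1) (by omega)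
  have h2 : 2 ^ A < 2 ^ (14 + padicValNat 2 A.factorial) := by
    rw [pow_add]
    exact (two_pow_le_succ_mul_two_pow_padicValNat_factorial A).trans_lt
      (Nat.mul_lt_mul_of_pos_right (by omega) (by positivity))
  have h3 := (Nat.pow_lt_pow_iff_right (by norm_num)).1 h2
  exact (pow_dvd_pow 2 (by omega)).trans pow_padicValNat_dvd

/-- The orders 6, 4, 3, 3 for `k = 2, 3, 4, 5`, and 2 for `k ≥ 6`, all satisfy `m k ≥ 12`. Every
position of `t` among the `k` factors is covered. -/
theorem not_checkAll {A B k F : ℕ} (hA : 150 ≤ A) (hA' : A < 16383) (hAB : A ≤ B) (hk : 2 ≤ k)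
    (hk' : k ≤ 14) (hB : B < 10 ^ 3000) (h : A.factorial = ∏ j ∈ Finset.range k, (B + 1 + j))
    (hF : (F : ℤ) ≡ A.factorial [ZMOD 2 ^ 10400]) (hc : checkAll A F (F * F) = true) : False := by
  have core : ∀ {m P Q : ℕ} {M S c t : ℤ}, 2 ≤ m → 12 ≤ m * k → (B + 1) ^ k ≤ A.factorial →
      0 ≤ t → t ≤ B + k → 2 ^ (A - 25) ∣ t → M = 2 ^ 10400 →
      farFromZero (precision m A) P Q = true → (P : ℤ) - Q ≡ S [ZMOD M] →
      t ^ m ∣ S - c * t → |c| ≤ 2 ^ 33 → False :=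
    fun hm hmk => not_farFromZero hA hAB hk hk' hm hmk hB
  clear hB
  obtain ⟨i, r, rfl, hv⟩ := exists_padicValNat_prod_range_le (B + 1) k (by omega) (by omega)
  have hpow := succ_pow_le_of_factorial_eq_prod h
  have hN := cast_prod_range_centred (B + 1) i r (by omega)
  rw [← h] at hN hv
  have h2t := two_pow_dvd_of_padicValNat_le hA' hk hk' hv
  have htB : ((B + 1 + i : ℕ) : ℤ) ≤ B + ((i + r + 1 : ℕ) : ℤ) := by push_cast; linarith
  generalize B + 1 + i = t' at *
  have h2t' : (2 : ℤ) ^ (A - 25) ∣ (t' : ℤ) := by exact_mod_cast h2t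
  have ht0 : (0 : ℤ) ≤ t' := by positivity
  generalize (t' : ℤ) = t at *
  -- The modulus becomes opaque, so that no tactic evaluates it.
  generalize hM : (2 : ℤ) ^ 10400 = M at hF
  generalize hNZ : (A.factorial : ℤ) = N at *
  simp only [checkAll, check2, check3, check4, check5, Bool.and_eq_true] at hc
  obtain ⟨c6, c2, ⟨c3a, c3b, c3c⟩, ⟨c4a, c4b⟩, c5a, c5b, c5c, c5d, c5e⟩ := hc
  -- For `k ≥ 6` first order is enough: `A! ≡ ± i! r! t` modulo `t²`, and `i! r! ≤ 13! < 2^33`.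
  rcases Nat.lt_or_ge 5 (i + r + 1) with h6 | h6
  · refine core le_rfl (by omega) hpow ht0 htB h2t' hM.symm c6 (S := N)
      (by simpa using hF) (hN ▸ sq_dvd_centred_prod_sub t i r) ?_
    rw [abs_mul, abs_mul, abs_pow]
    have : i.factorial * r.factorial ≤ 2 ^ 33 :=
      calc i.factorial * r.factorial ≤ (i + r).factorial :=
            Nat.le_of_dvd (Nat.factorial_pos _) (Nat.factorial_mul_factorial_dvd_factorial_add i r)
        _ ≤ (13).factorial := Nat.factorial_le (by omega)
        _ ≤ 2 ^ 33 := by decide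
    simp only [abs_neg, abs_one, one_pow, one_mul, Nat.abs_cast]
    exact_mod_cast this
  have use2 := fun {P Q : ℕ} (S c : ℤ) (hk2 : i + r + 1 = 2) =>
    core (P := P) (Q := Q) (S := S) (c := c) (m := 6) (by norm_num) (by omega) hpow ht0
      htB h2t' hM.symm
  have use3 := fun {P Q : ℕ} (S c : ℤ) (hk2 : i + r + 1 = 3) =>
    core (P := P) (Q := Q) (S := S) (c := c) (m := 4) (by norm_num) (by omega) hpow ht0
      htB h2t' hM.symm
  have use4 := fun {P Q : ℕ} (S c : ℤ) (hk2 : 4 ≤ i + r + 1) =>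
    core (P := P) (Q := Q) (S := S) (c := c) (m := 3) (by norm_num) (by omega) hpow ht0
      htB h2t' hM.symm
  clear hNZ hpow hv h h2t htB hAB
  have hcases : (i = 0 ∧ r = 1) ∨ (i = 1 ∧ r = 0) ∨ (i = 0 ∧ r = 2) ∨ (i = 1 ∧ r = 1) ∨
      (i = 2 ∧ r = 0) ∨ (i = 0 ∧ r = 3) ∨ (i = 1 ∧ r = 2) ∨ (i = 2 ∧ r = 1) ∨ (i = 3 ∧ r = 0) ∨
      (i = 0 ∧ r = 4) ∨ (i = 1 ∧ r = 3) ∨ (i = 2 ∧ r = 2) ∨ (i = 3 ∧ r = 1) ∨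
      (i = 4 ∧ r = 0) := by omega
  rcases hcases with ⟨rfl, rfl⟩ | ⟨rfl, rfl⟩ | ⟨rfl, rfl⟩ | ⟨rfl, rfl⟩ | ⟨rfl, rfl⟩ | ⟨rfl, rfl⟩ |
    ⟨rfl, rfl⟩ | ⟨rfl, rfl⟩ | ⟨rfl, rfl⟩ | ⟨rfl, rfl⟩ | ⟨rfl, rfl⟩ | ⟨rfl, rfl⟩ | ⟨rfl, rfl⟩ |
    ⟨rfl, rfl⟩ <;>
    simp only [Finset.prod_range_succ, Finset.prod_range_zero, Nat.cast_zero, Nat.cast_one,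
      Nat.cast_ofNat] at hN
  -- Here and in the cases below, the witness is the exact quotient of `S - c * t` by `t^m` once `N`
  -- is expanded in `t`.
  · refine use2 (N - N ^ 2 + 2 * N ^ 3 - 5 * N ^ 4 + 14 * N ^ 5) 1 rfl c2 ?_
      ⟨42 + 120 * t + 135 * t ^ 2 + 70 * t ^ 3 + 14 * t ^ 4, by rw [hN]; ring⟩
      (by norm_num)
    refine Int.ModEq.trans
      (b := (F : ℤ) - (F : ℤ) ^ 2 + 2 * (F : ℤ) ^ 3 - 5 * (F : ℤ) ^ 4 + 14 * (F : ℤ) ^ 5)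
      (congrArg (· % M) ?_) (by gcongr)
    simp only [Nat.mul_eq, Nat.add_eq]; push_cast; ring
  · refine use2 (N - N ^ 2 + 2 * N ^ 3 - 5 * N ^ 4 + 14 * N ^ 5) (-1) rfl c2 ?_
      ⟨42 - 120 * t + 135 * t ^ 2 - 70 * t ^ 3 + 14 * t ^ 4, by rw [hN]; ring⟩
      (by norm_num)
    refine Int.ModEq.trans
      (b := (F : ℤ) - (F : ℤ) ^ 2 + 2 * (F : ℤ) ^ 3 - 5 * (F : ℤ) ^ 4 + 14 * (F : ℤ) ^ 5)
      (congrArg (· % M) ?_) (by gcongr)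
    simp only [Nat.mul_eq, Nat.add_eq]; push_cast; ring
  · refine use3 (4 * N - 3 * N ^ 2 + 4 * N ^ 3) 8 rfl c3b ?_
      ⟨105 + 246 * t + 249 * t ^ 2 + 132 * t ^ 3 + 36 * t ^ 4 + 4 * t ^ 5, by rw [hN]; ring⟩
      (by norm_num)
    refine Int.ModEq.trans (b := 4 * (F : ℤ) - 3 * (F : ℤ) ^ 2 + 4 * (F : ℤ) ^ 3)
      (congrArg (· % M) ?_) (by gcongr)
    simp only [Nat.mul_eq, Nat.add_eq]; push_cast; ring
  · refine use3 (N + N ^ 3) (-1) rfl c3a ?_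
      ⟨3 * t - 3 * t ^ 3 + t ^ 5, by rw [hN]; ring⟩
      (by norm_num)
    refine Int.ModEq.trans (b := (F : ℤ) + (F : ℤ) ^ 3)
      (congrArg (· % M) ?_) (by gcongr)
    simp only [Nat.mul_eq, Nat.add_eq]; push_cast; ring
  · refine use3 (4 * N + 3 * N ^ 2 + 4 * N ^ 3) 8 rfl c3c ?_
      ⟨-105 + 246 * t - 249 * t ^ 2 + 132 * t ^ 3 - 36 * t ^ 4 + 4 * t ^ 5, by rw [hN]; ring⟩
      (by norm_num)
    refine Int.ModEq.trans (b := 4 * (F : ℤ) + 3 * (F : ℤ) ^ 2 + 4 * (F : ℤ) ^ 3)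
      (congrArg (· % M) ?_) (by gcongr)
    simp only [Nat.mul_eq, Nat.add_eq]; push_cast; ring
  · refine use4 (36 * N - 11 * N ^ 2) 216 (by norm_num) c4a ?_
      ⟨-1236 - 2087 * t - 1584 * t ^ 2 - 638 * t ^ 3 - 132 * t ^ 4 - 11 * t ^ 5, by rw [hN]; ring⟩
      (by norm_num)
    refine Int.ModEq.trans (b := 36 * (F : ℤ) - 11 * (F : ℤ) ^ 2)
      (congrArg (· % M) ?_) (by gcongr)
    simp only [Nat.mul_eq]; push_cast; ring
  · refine use4 (4 * N + N ^ 2) (-8) (by norm_num) c4b ?_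
      ⟨12 - 3 * t - 8 * t ^ 2 + 2 * t ^ 3 + 4 * t ^ 4 + t ^ 5, by rw [hN]; ring⟩
      (by norm_num)
    refine Int.ModEq.trans (b := 4 * (F : ℤ) + (F : ℤ) ^ 2)
      (congrArg (· % M) ?_) (by gcongr)
    simp only [Nat.mul_eq, Nat.add_eq]; push_cast; ring
  · refine use4 (4 * N + N ^ 2) 8 (by norm_num) c4b ?_
      ⟨-12 - 3 * t + 8 * t ^ 2 + 2 * t ^ 3 - 4 * t ^ 4 + t ^ 5, by rw [hN]; ring⟩
      (by norm_num)
    refine Int.ModEq.trans (b := 4 * (F : ℤ) + (F : ℤ) ^ 2)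
      (congrArg (· % M) ?_) (by gcongr)
    simp only [Nat.mul_eq, Nat.add_eq]; push_cast; ring
  · refine use4 (36 * N - 11 * N ^ 2) (-216) (by norm_num) c4a ?_
      ⟨1236 - 2087 * t + 1584 * t ^ 2 - 638 * t ^ 3 + 132 * t ^ 4 - 11 * t ^ 5, by rw [hN]; ring⟩
      (by norm_num)
    refine Int.ModEq.trans (b := 36 * (F : ℤ) - 11 * (F : ℤ) ^ 2)
      (congrArg (· % M) ?_) (by gcongr)
    simp only [Nat.mul_eq]; push_cast; ring
  · refine use4 (576 * N - 50 * N ^ 2) 13824 (by norm_num) c5b ?_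
      ⟨-99840 - 203240 * t - 198424 * t ^ 2 - 113650 * t ^ 3 - 40000 * t ^ 4 - 8500 * t ^ 5 -
        1000 * t ^ 6 - 50 * t ^ 7, by rw [hN]; ring⟩
      (by norm_num)
    refine Int.ModEq.trans (b := 576 * (F : ℤ) - 50 * (F : ℤ) ^ 2)
      (congrArg (· % M) ?_) (by gcongr)
    simp only [Nat.mul_eq]; push_cast; ring
  · refine use4 (36 * N + 5 * N ^ 2) (-216) (by norm_num) c5e ?_
      ⟨480 + 5 * t - 514 * t ^ 2 - 185 * t ^ 3 + 200 * t ^ 4 + 175 * t ^ 5 + 50 * t ^ 6 +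
        5 * t ^ 7, by rw [hN]; ring⟩
      (by norm_num)
    refine Int.ModEq.trans (b := 36 * (F : ℤ) + 5 * (F : ℤ) ^ 2)
      (congrArg (· % M) ?_) (by gcongr)
    simp only [Nat.mul_eq, Nat.add_eq]; push_cast; ring
  · refine use4 N 4 (by norm_num) c5a ?_
      ⟨-5 + t ^ 2, by rw [hN]; ring⟩
      (by norm_num)
    simpa using hF
  · refine use4 (36 * N - 5 * N ^ 2) (-216) (by norm_num) c5d ?_
      ⟨480 - 5 * t - 514 * t ^ 2 + 185 * t ^ 3 + 200 * t ^ 4 - 175 * t ^ 5 + 50 * t ^ 6 -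
        5 * t ^ 7, by rw [hN]; ring⟩
      (by norm_num)
    refine Int.ModEq.trans (b := 36 * (F : ℤ) - 5 * (F : ℤ) ^ 2)
      (congrArg (· % M) ?_) (by gcongr)
    simp only [Nat.mul_eq]; push_cast; ring
  · refine use4 (576 * N + 50 * N ^ 2) 13824 (by norm_num) c5c ?_
      ⟨-99840 + 203240 * t - 198424 * t ^ 2 + 113650 * t ^ 3 - 40000 * t ^ 4 + 8500 * t ^ 5 -
        1000 * t ^ 6 + 50 * t ^ 7, by rw [hN]; ring⟩
      (by norm_num)
    refine Int.ModEq.trans (b := 576 * (F : ℤ) + 50 * (F : ℤ) ^ 2)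
      (congrArg (· % M) ?_) (by gcongr)
    simp only [Nat.mul_eq, Nat.add_eq]; push_cast; ring

theorem checkFrom_succ (n A F : ℕ) : checkFrom (n + 1) A F =
    ((Nat.ble A 149 || checkAll A F (F * F)) &&
      checkFrom n (A + 1) (F * (A + 1) % Nat.pow 2 10400)) := rfl

theorem modEq_factorial_succ {A F M : ℕ} (h : F ≡ A.factorial [MOD M]) :
    F * (A + 1) % M ≡ (A + 1).factorial [MOD M] := by
  rw [Nat.factorial_succ, mul_comm (A + 1)]
  exact (Nat.mod_modEq _ _).trans (h.mul_right _)

theorem exists_checkAll_of_checkFrom {n A F A' : ℕ} (h : checkFrom n A F = true)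
    (hF : F ≡ A.factorial [MOD Nat.pow 2 10400]) (h₁ : A ≤ A') (h₂ : A' < A + n)
    (h₃ : 150 ≤ A') :
    ∃ F', F' ≡ A'.factorial [MOD Nat.pow 2 10400] ∧ checkAll A' F' (F' * F') = true := by
  induction n generalizing A F with
  | zero => omega
  | succ n ih =>
    rw [checkFrom_succ, Bool.and_eq_true] at h
    rcases Nat.eq_or_lt_of_le h₁ with rfl | hlt
    · refine ⟨F, hF, ?_⟩
      have : Nat.ble A 149 = false := by
        rw [Bool.eq_false_iff]; intro h'; exact absurd (Nat.le_of_ble_eq_true h') (by omega)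
      simpa [this] using h.1
    · exact ih h.2 (modEq_factorial_succ hF) hlt (by omega)

theorem factorial_mul_factorialTree (d a : ℕ) :
    a.factorial * factorialTree d a = (a + 2 ^ d).factorial := by
  induction d generalizing a with
  | zero =>
    show a.factorial * (a + 1) = (a + 1).factorial
    rw [Nat.factorial_succ, mul_comm]
  | succ d ih =>
    show a.factorial * (factorialTree d a * factorialTree d (a + 2 ^ d)) = _
    rw [← mul_assoc, ih, ih, pow_succ, mul_two, add_assoc]

theorem blockFactorial_modEq (j : ℕ) :
    blockFactorial j ≡ (512 * j).factorial [MOD Nat.pow 2 10400] := by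
  induction j with
  | zero =>
    have : blockFactorial 0 = (512 * 0).factorial := rfl
    rw [this]
  | succ j ih =>
    show blockFactorial j * factorialTree 9 (512 * j) % Nat.pow 2 10400 ≡ _ [MOD _]
    have := factorial_mul_factorialTree 9 (512 * j)
    rw [show 512 * (j + 1) = 512 * j + 2 ^ 9 by ring, ← this]
    exact (Nat.mod_modEq _ _).trans (ih.mul_right _)

theorem intModEq_two_pow {a b e : ℕ} (h : a ≡ b [MOD Nat.pow 2 e]) :
    (a : ℤ) ≡ b [ZMOD 2 ^ e] := by
  have := (Int.natCast_modEq_iff (n := 2 ^ e)).2 h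
  exact_mod_cast this

/-- Twenty blocks of 512 exhaust `A < 10240`. -/
theorem checkFrom_block {j : ℕ} (hj : j < 20) :
    checkFrom 512 (Nat.mul 512 j) (blockFactorial j) = true := by
  interval_cases j <;> decide +kernel

/-- No nontrivial solution has `150 ≤ A` and both `A` and `B` in the given range. -/
theorem factorial_ne_prod_of_lt {A B k : ℕ} (hA : 150 ≤ A) (hA' : A < 10240) (hAB : A ≤ B)
    (hk : 2 ≤ k) (hk' : k ≤ 14) (hB : B < 10 ^ 3000) :
    A.factorial ≠ ∏ j ∈ Finset.range k, (B + 1 + j) := by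
  intro h
  obtain ⟨F, hF, hc⟩ := exists_checkAll_of_checkFrom (A' := A)
    (checkFrom_block (j := A / 512) (by omega)) (blockFactorial_modEq _)
    (Nat.mul_div_le A 512) (Nat.lt_mul_div_succ A (by norm_num)) hA
  have hA2 : A < 16383 := hA'.trans (by norm_num)
  have hF' := intModEq_two_pow hF
  exact not_checkAll hA hA2 hAB hk hk' hB h hF' hc

/-! ### The range `A < 150`. -/

/-- A few steps of Newton's iteration towards the `k`-th root of `N`. -/
def newtonRoot (k N n : ℕ) : ℕ :=
  Nat.rec (Nat.pow 2 (Nat.succ (Nat.div (Nat.log2 N) k)))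
    (fun _ y => Nat.div (Nat.add (Nat.mul (Nat.pred k) y) (Nat.div N (Nat.pow y (Nat.pred k)))) k) n

/-- `N` lies strictly between two values of `x ↦ x (x + 1) ⋯ (x + k - 1)` near `x`, and is none of
the values in between. -/
def isBracketed (k N x : ℕ) : Bool :=
  Nat.blt (Nat.ascFactorial x k) N && (Nat.blt N (Nat.ascFactorial (x + 4) k) &&
  (!Nat.beq (Nat.ascFactorial (x + 1) k) N && (!Nat.beq (Nat.ascFactorial (x + 2) k) N &&
    !Nat.beq (Nat.ascFactorial (x + 3) k) N)))

/-- A test showing that `N = A!` is not a product of `k` consecutive integers above `A`, apart from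
`6! = 8 * 9 * 10`. -/
def checkSmall (A N k : ℕ) : Bool :=
  Nat.blt N (Nat.pow (Nat.succ A) k) ||
  (Nat.blt N (Nat.pow (Nat.succ (Nat.sub (Nat.div (Nat.pow 2 (Nat.add A 2))
    (Nat.mul (Nat.succ A) (Nat.pow 2 k))) k)) k) ||
  (isBracketed k N (Nat.sub (newtonRoot k N 16) (Nat.succ (Nat.div k 2))) ||
  (Nat.blt N (Nat.ascFactorial (Nat.succ A) k) || (Nat.beq A 6 && Nat.beq k 3))))

theorem checkSmall_of_lt : ∀ A < 150, ∀ k < 150, 2 ≤ k → checkSmall A A.factorial k = true := by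
  decide +kernel

theorem ascFactorial_le_ascFactorial {x y : ℕ} (h : x ≤ y) (k : ℕ) :
    x.ascFactorial k ≤ y.ascFactorial k := by
  rw [Nat.ascFactorial_eq_prod_range, Nat.ascFactorial_eq_prod_range]
  exact Finset.prod_le_prod' fun j _ => by omega

theorem lt_of_blt_eq_true {a b : ℕ} (h : Nat.blt a b = true) : a < b :=
  Nat.le_of_ble_eq_true h

theorem ne_of_not_beq {a b : ℕ} (h : (!Nat.beq a b) = true) : a ≠ b := by
  rintro rfl
  rw [Nat.beq_refl] at h
  exact absurd h (by decide)

/-- Rising factorials are monotone in the base. The bracket is itself tested, so nothing about the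
accuracy of `newtonRoot` has to be proved. -/
theorem ascFactorial_ne_of_isBracketed {k N x : ℕ} (h : isBracketed k N x = true) (y : ℕ) :
    y.ascFactorial k ≠ N := by
  simp only [isBracketed, Bool.and_eq_true] at h
  obtain ⟨h0, h4, h1, h2, h3⟩ := h
  rcases Nat.lt_or_ge x y with hy | hy
  · rcases Nat.lt_or_ge y (x + 4) with hy' | hy'
    · obtain rfl | rfl | rfl : y = x + 1 ∨ y = x + 2 ∨ y = x + 3 := by omega
      exacts [ne_of_not_beq h1, ne_of_not_beq h2, ne_of_not_beq h3]
    · exact ((lt_of_blt_eq_true h4).trans_le (ascFactorial_le_ascFactorial hy' k)).ne'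
  · exact ((ascFactorial_le_ascFactorial hy k).trans_lt (lt_of_blt_eq_true h0)).ne

theorem lt_of_factorial_eq_prod {A B k : ℕ} (hA : A ≠ 0) (hAB : A ≤ B)
    (h : A.factorial = ∏ j ∈ Finset.range k, (B + 1 + j)) : k < A := by
  have h1 : (A + 1) ^ k ≤ A ^ A :=
    (Nat.pow_le_pow_left (by omega) k).trans
      ((succ_pow_le_of_factorial_eq_prod h).trans (Nat.factorial_le_pow A))
  by_contra! hk
  have h2 : (A + 1) ^ A ≤ A ^ A := (Nat.pow_le_pow_right (by omega) hk).trans h1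
  exact absurd h2 (Nat.pow_lt_pow_left (by omega) hA).not_ge

/-- The disjuncts of the test exclude, in turn: too many factors for `A!`; a `B` forced too large by
the two-adic bound; `A!` strictly between consecutive values of the product; a product already too
large at `B = A`. What remains is the exception. -/
theorem eq_of_checkSmall {A B k : ℕ} (hAB : A ≤ B) (hk : 2 ≤ k)
    (h : A.factorial = ∏ j ∈ Finset.range k, (B + 1 + j))
    (hc : checkSmall A A.factorial k = true) : A = 6 ∧ k = 3 := by
  have hpow := succ_pow_le_of_factorial_eq_prod h
  have h' : (B + 1).ascFactorial k = A.factorial := by rw [h, Nat.ascFactorial_eq_prod_range]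
  simp only [checkSmall, Bool.or_eq_true, Bool.and_eq_true] at hc
  rcases hc with hc | hc | hc | hc | ⟨h1, h2⟩
  · exact absurd ((Nat.pow_le_pow_left (by omega) k).trans hpow) (lt_of_blt_eq_true hc).not_ge
  · have h2 : 2 ^ (A + 2) / ((A + 1) * 2 ^ k) ≤ B + k := by
      apply Nat.div_le_of_le_mul
      calc _ ≤ _ := two_pow_le_of_factorial_eq_prod hk h
        _ = _ := by ring
    have h3 : (2 ^ (A + 2) / ((A + 1) * 2 ^ k) - k + 1) ^ k ≤ (B + 1) ^ k :=
      Nat.pow_le_pow_left (by omega) k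
    exact absurd (h3.trans hpow) (lt_of_blt_eq_true hc).not_ge
  · exact absurd h' (ascFactorial_ne_of_isBracketed hc _)
  · have := ascFactorial_le_ascFactorial (show A + 1 ≤ B + 1 by omega) k
    rw [h'] at this
    exact absurd this (lt_of_blt_eq_true hc).not_ge
  · exact ⟨Nat.eq_of_beq_eq_true h1, Nat.eq_of_beq_eq_true h2⟩

theorem eq_of_factorial_eq_prod_of_lt {A B k : ℕ} (hA0 : A ≠ 0) (hA : A < 150) (hAB : A ≤ B)
    (hk : 2 ≤ k) (h : A.factorial = ∏ j ∈ Finset.range k, (B + 1 + j)) :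
    A = 6 ∧ B = 7 ∧ k = 3 := by
  have hkA := lt_of_factorial_eq_prod hA0 hAB h
  obtain ⟨rfl, rfl⟩ := eq_of_checkSmall hAB hk h (checkSmall_of_lt A hA k (by omega) hk)
  refine ⟨rfl, ?_, rfl⟩
  have hB : (B + 1).ascFactorial 3 = 720 := by rw [Nat.ascFactorial_eq_prod_range, ← h]; rfl
  have h7 : ¬ B ≤ 6 := fun hB' => by
    have := ascFactorial_le_ascFactorial (show B + 1 ≤ 7 by omega) 3
    rw [hB] at this
    exact absurd this (by decide)
  have h8 : ¬ 8 ≤ B := fun hB' => by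
    have := ascFactorial_le_ascFactorial (show 9 ≤ B + 1 by omega) 3
    rw [hB] at this
    exact absurd this (by decide)
  omega

/-! ### The bound `B ≥ 10^3000`. -/

theorem logb_succ_le_of_lt {B : ℕ} (hB : B < 10 ^ 3000) : Real.logb 2 ((B : ℝ) + 1) ≤ 9966 := by
  rw [Real.logb_le_iff_le_rpow (by norm_num) (Nat.cast_add_one_pos B),
    show (9966 : ℝ) = ((9966 : ℕ) : ℝ) by norm_num, Real.rpow_natCast]
  have h0 : 10 ^ 3000 ≤ 2 ^ 9966 := by set_option exponentiation.threshold 20000 in norm_num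
  have h1 : B + 1 ≤ 2 ^ 9966 := le_trans hB h0
  exact_mod_cast h1

theorem lt_of_factorial_eq_prod_of_logb_le {A B k : ℕ} (hA : 150 ≤ A) (hAB : A ≤ B) (hk : 2 ≤ k)
    (hx : Real.logb 2 ((B : ℝ) + 1) ≤ 9966)
    (h : A.factorial = ∏ j ∈ Finset.range k, (B + 1 + j)) :
    A < 10240 ∧ k ≤ 14 := by
  have hkL := lt_logb_succ_add_one_of_factorial_eq_prod hA hAB hk h
  have F1 := add_two_le_logb_of_factorial_eq_prod hk h
  have hL := two_mul_sq_logb_succ_le hA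
  have hkA : (k : ℝ) ≤ B := by
    exact_mod_cast (lt_of_factorial_eq_prod (by omega) hAB h).le.trans hAB
  have F4 : Real.logb 2 ((B : ℝ) + k) ≤ Real.logb 2 ((B : ℝ) + 1) + 1 := by
    have : Real.logb 2 (((B : ℝ) + 1) * 2) = Real.logb 2 ((B : ℝ) + 1) + 1 := by
      rw [Real.logb_mul (by positivity) (by norm_num), Real.logb_self_eq_one (by norm_num)]
    rw [← this]
    exact Real.logb_le_logb_of_le (by norm_num) (by positivity) (by linarith)
  -- With `L = log₂ (A+1)`, the estimates give `A < 9966 + 2 L`, while `2 L² ≤ A` keeps `2 L` below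
  -- the remaining gap.
  have hA' : A < 10240 := by
    by_contra! hcon
    have hcon' : (10240 : ℝ) ≤ A := by exact_mod_cast hcon
    nlinarith
  refine ⟨hA', ?_⟩
  have h14 : Real.logb 2 ((A : ℝ) + 1) ≤ 14 := by
    rw [Real.logb_le_iff_le_rpow (by norm_num) (by positivity)]
    have : (A : ℝ) + 1 ≤ 10240 := by exact_mod_cast hA'
    exact this.trans (by norm_num)
  have : (k : ℝ) < 15 := by linarith
  exact Nat.lt_succ_iff.1 (by exact_mod_cast this)

/-- Apart from `6! 7! = 10!`, a nontrivial solution has `B ≥ 10 ^ 3000`. -/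
theorem ten_pow_le_of_factorial_eq_prod {A B k : ℕ} (hA0 : A ≠ 0) (hAB : A ≤ B) (hk : 2 ≤ k)
    (h : A.factorial = ∏ j ∈ Finset.range k, (B + 1 + j)) (hne : ¬ (A = 6 ∧ B = 7 ∧ k = 3)) :
    150 ≤ A ∧ 10 ^ 3000 ≤ B := by
  have hA : 150 ≤ A := by
    by_contra! hA
    exact hne (eq_of_factorial_eq_prod_of_lt hA0 hA hAB hk h)
  refine ⟨hA, not_lt.1 fun hB => ?_⟩
  obtain ⟨hA', hk'⟩ := lt_of_factorial_eq_prod_of_logb_le hA hAB hk (logb_succ_le_of_lt hB) h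
  exact factorial_ne_prod_of_lt hA hA' hAB hk hk' hB h

/-! ### Explicit estimates for large `B`. -/

/-- The Stirling sequence decreases, so its first term bounds it; this gives the constant 1. -/
theorem log_factorial_le {n : ℕ} (hn : n ≠ 0) :
    Real.log n.factorial ≤ n * Real.log n - n + Real.log n / 2 + 1 := by
  obtain ⟨m, rfl⟩ := Nat.exists_eq_succ_of_ne_zero hn
  have h := Stirling.log_stirlingSeq'_antitone (Nat.zero_le m)
  simp only [Function.comp_apply, Stirling.log_stirlingSeq_formula] at h
  have hm : (0 : ℝ) < (m.succ : ℕ) := by positivity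
  rw [Real.log_div hm.ne' (Real.exp_pos 1).ne', Real.log_mul (by norm_num) hm.ne'] at h
  simp only [Nat.succ_eq_add_one, Nat.zero_add, Nat.factorial_one, Nat.cast_one, Real.log_one,
    Real.log_exp, mul_one, one_div, Real.log_inv, one_mul] at h
  simp only [Nat.succ_eq_add_one]
  linarith

/-- 8.8 is a convenient value just below `log 6900`; it serves as base point for `log l` in
`log_bounds`. -/
theorem exp_eight_point_eight_bounds : (6630 : ℝ) ≤ Real.exp 8.8 ∧ Real.exp 8.8 ≤ 6900 := by
  have h : Real.exp 8.8 ^ 5 = Real.exp 1 ^ 44 := by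
    rw [← Real.exp_nat_mul, ← Real.exp_nat_mul]; norm_num
  constructor
  · refine le_of_pow_le_pow_left₀ (by norm_num : (5 : ℕ) ≠ 0) (Real.exp_pos _).le ?_
    rw [h]
    calc (6630 : ℝ) ^ 5 ≤ 2.7182818283 ^ 44 := by norm_num
      _ ≤ _ := pow_le_pow_left₀ (by norm_num) Real.exp_one_gt_d9.le _
  · refine le_of_pow_le_pow_left₀ (by norm_num : (5 : ℕ) ≠ 0) (by norm_num) ?_
    rw [h]
    calc Real.exp 1 ^ 44 ≤ 2.7182818286 ^ 44 :=
          pow_le_pow_left₀ (Real.exp_pos _).le Real.exp_one_lt_d9.le _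
      _ ≤ _ := by norm_num

theorem neg_log_log_two_le : -Real.log (Real.log 2) ≤ 0.3666 := by
  have hg := Real.log_two_gt_d9
  rw [neg_le, Real.le_log_iff_exp_le (by linarith), Real.exp_neg]
  have h := Real.sum_le_exp_of_nonneg (x := 0.3666) (by norm_num) 6
  norm_num [Finset.sum_range_succ, Nat.factorial] at h
  have h' : (1.4428 : ℝ) ≤ Real.exp 0.3666 := by norm_num; linarith
  refine (inv_anti₀ (by norm_num) h').trans ?_
  exact (by norm_num : (1.4428 : ℝ)⁻¹ ≤ 0.6931471803).trans hg.le

theorem log_ten_ge : (2.3 : ℝ) ≤ Real.log 10 := by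
  rw [Real.le_log_iff_exp_le (by norm_num)]
  refine le_of_pow_le_pow_left₀ (by norm_num : (10 : ℕ) ≠ 0) (by norm_num) ?_
  have h : Real.exp 2.3 ^ 10 = Real.exp 1 ^ 23 := by
    rw [← Real.exp_nat_mul, ← Real.exp_nat_mul]; norm_num
  rw [h]
  calc Real.exp 1 ^ 23 ≤ 2.7182818286 ^ 23 :=
        pow_le_pow_left₀ (Real.exp_pos _).le Real.exp_one_lt_d9.le _
    _ ≤ _ := by norm_num

/-- The tangent of `log` at `e^8`, with `e^8` lowered to 2900. -/
theorem log_le_div_add (a : ℝ) (ha : 0 < a) : Real.log a ≤ a / 2900 + 7 := by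
  have h1 : Real.log (a / Real.exp 8) = Real.log a - 8 := by
    rw [Real.log_div ha.ne' (Real.exp_pos _).ne', Real.log_exp]
  have h2 := Real.log_le_sub_one_of_pos (div_pos ha (Real.exp_pos 8))
  have h3 : (2900 : ℝ) ≤ Real.exp 8 := by
    rw [show (8 : ℝ) = (8 : ℕ) * 1 by norm_num, Real.exp_nat_mul]
    calc (2900 : ℝ) ≤ 2.7182818283 ^ 8 := by norm_num
      _ ≤ _ := pow_le_pow_left₀ (by norm_num) Real.exp_one_gt_d9.le _
  have h4 : a / Real.exp 8 ≤ a / 2900 := div_le_div_of_nonneg_left ha.le (by norm_num) h3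
  linarith

/-- Here `a` and `l` stand for `A` and `log (B + 1)`, and `K` for `(C - B) log 2`. -/
theorem log_bounds {a l K : ℝ} (ha : 1 ≤ a) (hl : 6900 ≤ l)
    (h₁ : a * Real.log 2 ≤ Real.log (a + 1) + l + 0.001 + K - 2 * Real.log 2)
    (h₂ : K * l ≤ Real.log 2 * (a * Real.log a - a + Real.log a / 2 + 1))
    (h₃ : K < Real.log (a + 1) + Real.log 2) :
    K ≤ Real.log l - 0.8803 * Real.log 2 ∧
      a * Real.log 2 ≤ l + 2 * Real.log l - 1.3479 * Real.log 2 := by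
  have hg1 := Real.log_two_gt_d9
  have hg2 := Real.log_two_lt_d9
  have hgl := neg_log_log_two_le
  have hl0 : 0 < l := by linarith
  have ha0 : 0 < a := by linarith
  have hu : 8.8 ≤ Real.log l := by
    rw [Real.le_log_iff_exp_le hl0]
    exact exp_eight_point_eight_bounds.2.trans hl
  have hlu : 6630 * (1 + (Real.log l - 8.8) + (Real.log l - 8.8) ^ 2 / 2) ≤ l := by
    have e : l = Real.exp 8.8 * Real.exp (Real.log l - 8.8) := by
      rw [← Real.exp_add, add_sub_cancel, Real.exp_log hl0]
    have h := Real.quadratic_le_exp_of_nonneg (sub_nonneg.2 hu)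
    calc _ ≤ Real.exp 8.8 * Real.exp (Real.log l - 8.8) :=
          mul_le_mul exp_eight_point_eight_bounds.1 h (by nlinarith) (Real.exp_pos _).le
      _ = l := e.symm
  set g := Real.log 2
  have hg0 : 0 < g := by linarith
  set u := Real.log l
  have hLA := log_le_div_add (a + 1) (by linarith)
  have hag : (a + 1) * g ≤ 1.01 * l := by nlinarith
  have hLu : Real.log (a + 1) ≤ u + 0.3766 := by
    have h := Real.log_le_log (by positivity) hag
    rw [Real.log_mul (by positivity) hg0.ne', Real.log_mul (by norm_num) hl0.ne'] at h
    have h' := Real.log_le_sub_one_of_pos (show (0 : ℝ) < 1.01 by norm_num)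
    linarith
  have hlaLA : Real.log a ≤ Real.log (a + 1) := Real.log_le_log ha0 (by linarith)
  -- `η` is the relative error of `a log 2 ≈ l`. To leading order `h₂` reads `K ≤ log l - log (log
  -- 2) - 1`, about `log l - 0.6335`; the rest of the argument controls the loss caused by `η`.
  obtain ⟨η, hη⟩ : ∃ η, a * g = l * (1 + η) := ⟨a * g / l - 1, by field_simp; ring⟩
  have hη0 : 0 < 1 + η := by
    by_contra! hcon
    nlinarith [mul_pos ha0 hg0]
  have hla : Real.log a ≤ u + 0.3666 + η := by
    have h := congrArg Real.log hη
    rw [Real.log_mul ha0.ne' hg0.ne', Real.log_mul hl0.ne' hη0.ne'] at h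
    have := Real.log_le_sub_one_of_pos hη0
    linarith
  have hη1 : l * η ≤ u + K - 1.0086 := by linarith
  have hK : K * l ≤ l * ((1 + η) * (u - 0.6334 + η)) + g * ((u + 0.3766) / 2 + 1) := by
    have e : g * (a * Real.log a - a + Real.log a / 2 + 1) =
        a * g * (Real.log a - 1) + g * (Real.log a / 2 + 1) := by ring
    have e1 : a * g * (Real.log a - 1) ≤ a * g * (u - 0.6334 + η) :=
      mul_le_mul_of_nonneg_left (by linarith) (by positivity)
    have e2 : g * (Real.log a / 2 + 1) ≤ g * ((u + 0.3766) / 2 + 1) :=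
      mul_le_mul_of_nonneg_left (by linarith) hg0.le
    have e3 : a * g * (u - 0.6334 + η) = l * ((1 + η) * (u - 0.6334 + η)) := by rw [hη]; ring
    linarith
  obtain ⟨d, hd⟩ : ∃ d, u = 8.8 + d := ⟨u - 8.8, by ring⟩
  have hd0 : 0 ≤ d := by linarith
  rw [hd] at hlu hK hη1 hLu hla ⊢
  have hlu' : 6630 * (1 + d + d ^ 2 / 2) ≤ l := by
    rwa [show 8.8 + d - 8.8 = d by ring] at hlu
  have hd2 := sq_nonneg d
  -- an upper bound for `η` gives one for `K`
  have step : ∀ v, 0 ≤ v → l * η ≤ v → v ≤ 0.0027 * l →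
      K * l ≤ l * (8.8 + d - 0.6334) + v * (8.8 + d + 0.3693) + g * ((8.8 + d + 0.3766) / 2 + 1) := by
    intro v hv0 hv hvl
    have hη2 : η ≤ 0.0027 := by nlinarith
    have e : l * ((1 + η) * (8.8 + d - 0.6334 + η)) =
      l * (8.8 + d - 0.6334) + (l * η) * (8.8 + d + 0.3666 + η) := by ring
    have e1 : (l * η) * (8.8 + d + 0.3666 + η) ≤ v * (8.8 + d + 0.3666 + η) :=
      mul_le_mul_of_nonneg_right hv (by linarith)
    have e2 : v * (8.8 + d + 0.3666 + η) ≤ v * (8.8 + d + 0.3693) :=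
      mul_le_mul_of_nonneg_left (by linarith) hv0
    linarith
  have hgd : g * ((8.8 + d + 0.3766) / 2 + 1) ≤ 0.69315 * ((8.8 + d + 0.3766) / 2 + 1) :=
    mul_le_mul_of_nonneg_right (by linarith) (by linarith)
  -- First round: `h₃` gives `K < u + 1.07`, hence `l * η ≤ 2 u + 0.062`.
  have hK1 : K ≤ 8.8 + d - 0.6 := by
    have h := step (2 * (8.8 + d) + 0.062) (by linarith) (by linarith) (by linarith)
    have : (K - (8.8 + d - 0.6)) * l ≤ 0 := by linarith
    by_contra! hcon
    exact absurd this (mul_pos (sub_pos.2 hcon) hl0).not_ge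
  -- Second round, fed with `hK1`: now `l * η ≤ 2 u - 1.6086`. The target 0.61018 is `0.8803 * log
  -- 2` rounded up.
  have hK2 : K ≤ 8.8 + d - 0.61018 := by
    have h := step (2 * (8.8 + d) - 1.6086) (by linarith) (by linarith) (by linarith)
    have : (K - (8.8 + d - 0.61018)) * l ≤ 0 := by linarith
    by_contra! hcon
    exact absurd this (mul_pos (sub_pos.2 hcon) hl0).not_ge
  constructor <;> linarith

section consecutive

variable {A B k : ℕ}

theorem log_bounds_of_factorial_eq_prod (hA : 150 ≤ A) (hAB : A ≤ B) (hk : 2 ≤ k)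
    (hl : 6900 ≤ Real.log ((B : ℝ) + 1))
    (h : A.factorial = ∏ j ∈ Finset.range k, (B + 1 + j)) :
    (k : ℝ) * Real.log 2 ≤ Real.log (Real.log ((B : ℝ) + 1)) - 0.8803 * Real.log 2 ∧
      (A : ℝ) * Real.log 2 ≤ Real.log ((B : ℝ) + 1) + 2 * Real.log (Real.log ((B : ℝ) + 1)) -
        1.3479 * Real.log 2 := by
  have hg0 : 0 < Real.log 2 := Real.log_pos (by norm_num)
  have hkL := lt_logb_succ_add_one_of_factorial_eq_prod hA hAB hk h
  have F1 := add_two_le_logb_of_factorial_eq_prod hk h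
  have hA1 : (1 : ℝ) ≤ A := by exact_mod_cast (by omega : 1 ≤ A)
  have hAB' : (A : ℝ) ≤ B := by exact_mod_cast hAB
  have hB0 : (0 : ℝ) < (B : ℝ) + 1 := by positivity
  have hk2 : (2 : ℝ) ≤ k := by exact_mod_cast hk
  have e2 : Real.log (A + 1) = Real.logb 2 ((A : ℝ) + 1) * Real.log 2 := by
    rw [Real.logb, div_mul_cancel₀ _ hg0.ne']
  have e3 : Real.log (B + k) = Real.logb 2 ((B : ℝ) + k) * Real.log 2 := by
    rw [Real.logb, div_mul_cancel₀ _ hg0.ne']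
  have h3 : (k : ℝ) * Real.log 2 < Real.log (A + 1) + Real.log 2 := by
    rw [e2]; nlinarith
  have hAl : Real.log (A + 1) ≤ Real.log (B + 1) := Real.log_le_log (by linarith) (by linarith)
  -- By `h3`, `k` is at most of order `log (B+1)`, negligible against `B + 1 = e^l ≥ l²/2`.
  have hlog : Real.log (B + k) ≤ Real.log (B + 1) + 0.001 := by
    set l := Real.log ((B : ℝ) + 1)
    have hB2 : l ^ 2 / 2 ≤ (B : ℝ) + 1 := by
      have := Real.quadratic_le_exp_of_nonneg (by linarith : 0 ≤ l)
      rw [Real.exp_log hB0] at this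
      linarith
    have hkB : ((k : ℝ) - 1) / (B + 1) ≤ 0.001 := by
      rw [div_le_iff₀ hB0]
      have := Real.log_two_gt_d9
      nlinarith
    have hr : ((B : ℝ) + k) = (B + 1) * (1 + (k - 1) / (B + 1)) := by field_simp; ring
    have hp : 0 < 1 + ((k : ℝ) - 1) / (B + 1) := by
      have : 0 ≤ ((k : ℝ) - 1) / (B + 1) := div_nonneg (by linarith) hB0.le
      linarith
    have := Real.log_le_sub_one_of_pos hp
    rw [hr, Real.log_mul hB0.ne' hp.ne']
    linarith
  refine log_bounds hA1 hl ?_ ?_ h3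
  · have := mul_le_mul_of_nonneg_right F1 hg0.le
    rw [add_mul, add_mul, add_mul, ← e2, ← e3] at this
    linarith
  · have hpow : ((B : ℝ) + 1) ^ k ≤ A.factorial := by
      exact_mod_cast succ_pow_le_of_factorial_eq_prod h
    have h4 := Real.log_le_log (by positivity) hpow
    rw [Real.log_pow] at h4
    have h5 := h4.trans (log_factorial_le (by omega))
    calc _ = Real.log 2 * ((k : ℝ) * Real.log (B + 1)) := by ring
      _ ≤ _ := mul_le_mul_of_nonneg_left h5 hg0.le

end consecutive

theorem log_succ_ge_of_ten_pow_le {B : ℕ} (hB : 10 ^ 3000 ≤ B) :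
    6900 ≤ Real.log ((B : ℝ) + 1) := by
  have h1 : (10 : ℝ) ^ 3000 ≤ (B : ℝ) := by exact_mod_cast hB
  have h2 := Real.log_le_log (pow_pos (by norm_num) _) (h1.trans (le_add_of_nonneg_right zero_le_one))
  rw [Real.log_pow] at h2
  have h3 := log_ten_ge
  clear h1 hB
  push_cast at h2
  linarith

theorem theorem4 (A B C : ℕ) (hsol : IsNontrivialSolution A B C)
    (hne : (A, B, C) ≠ (6, 7, 10)) :
    10 ^ 3000 ≤ B ∧
    (A : ℝ) ≤ Real.log ((B : ℝ) + 1) / Real.log 2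
        + 2 * Real.log (Real.log ((B : ℝ) + 1)) / Real.log 2 - 1.3479 ∧
    (C : ℝ) - (B : ℝ) ≤ Real.log (Real.log ((B : ℝ) + 1)) / Real.log 2 - 0.8803 ∧
    (B : ℝ) - (A : ℝ) > (C : ℝ) - Real.log ((C : ℝ) + 1) / Real.log 2
        - 3 * Real.log (Real.log ((C : ℝ) + 1)) / Real.log 2 + 2.2282 := by
  obtain ⟨k, hk, rfl, hAB, h⟩ := hsol.exists_prod
  obtain ⟨hA, hB⟩ := ten_pow_le_of_factorial_eq_prod hsol.1.ne' hAB hk h (by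
    rintro ⟨rfl, rfl, rfl⟩
    exact hne rfl)
  have hl := log_succ_ge_of_ten_pow_le hB
  refine ⟨hB, ?_⟩
  clear hB hne
  obtain ⟨hK, hA'⟩ := log_bounds_of_factorial_eq_prod hA hAB hk hl h
  have hg0 : 0 < Real.log 2 := Real.log_pos (by norm_num)
  have hB0 : (0 : ℝ) ≤ B := Nat.cast_nonneg B
  have hk0 : (2 : ℝ) ≤ k := by exact_mod_cast hk
  have b1 : (A : ℝ) ≤ Real.log ((B : ℝ) + 1) / Real.log 2
      + 2 * Real.log (Real.log ((B : ℝ) + 1)) / Real.log 2 - 1.3479 := by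
    rw [← add_div, le_sub_iff_add_le, le_div_iff₀ hg0]
    linarith
  have b2 : (k : ℝ) ≤ Real.log (Real.log ((B : ℝ) + 1)) / Real.log 2 - 0.8803 := by
    rw [le_sub_iff_add_le, le_div_iff₀ hg0]
    linarith
  have c1 : Real.log ((B : ℝ) + 1) < Real.log (((B + k : ℕ) : ℝ) + 1) :=
    Real.log_lt_log (by linarith) (by push_cast; linarith)
  have c2 : Real.log (Real.log ((B : ℝ) + 1)) < Real.log (Real.log (((B + k : ℕ) : ℝ) + 1)) :=
    Real.log_lt_log (by linarith) c1
  refine ⟨b1, by push_cast; linarith, ?_⟩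
  -- The last inequality is the sum of `b1` and `b2`, with 1.3479 + 0.8803 = 2.2282; it is strict
  -- because `B + 1` is replaced by the larger `C + 1`.
  have d1 := (div_lt_div_iff_of_pos_right hg0).2 c1
  have d2 := (div_lt_div_iff_of_pos_right hg0).2 c2
  have e1 : ((B + k : ℕ) : ℝ) = B + k := by push_cast; rfl
  rw [mul_div_assoc] at b1 ⊢
  linarith
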